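/- Let $X$ be a real reflexive Banach space, let $K\subseteq X$ be nonempty, convex and closed, and let $D\subseteq K$ be self segment-dense in $K$ with respect to the weak topology of $X$; that is, $D$ is weakly dense in $K$ and, for all $u,v\in D$, the set $[u,v]\cap D$ is weakly dense in the segment $[u,v]=\{u+t(v-u):t\in[0,1]\}$. Let $F:K\times K\rightrightarrows\mathbb{R}$ be a set-valued map, so that $F(x,y)\subseteq\mathbb{R}$ for all $x,y\in K$, and put $\mathbb{R}_+=[0,\infty)$. A set-valued map $T:K\rightrightarrows\mathbb{R}$ is called weakly upper semicontinuous at $a\in K$ if for every open $N\subseteq\mathbb{R}$ with $T(a)\subseteq N$ there is a weak neighbourhood $M$ of $a$ such that $T(x)\subseteq N$ for all $x\in M\cap K$. It is called concave on $D$ if for all $n\ge 1$, $x_1,\dots,x_n\in D$ and $\lambda_1,\dots,\lambda_n\ge 0$ with $\sum_{i=1}^n\lambda_i=1$ and $\sum_{i=1}^n\lambda_i x_i\in D$ one has $$T\Big(\sum_{i=1}^n\lambda_i x_i\Big)\subseteq\sum_{i=1}^n\lambda_i T(x_i)\qquad\text{(Minkowski sum)}.$$ Assume that: 1. for every $y\in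 D$, the map $x\mapsto F(x,y)$ is weakly upper semicontinuous at every point of $K$; 2. for every $x\in K$, the map $y\mapsto F(x,y)$ is weakly upper semicontinuous at every point of $K\setminus D$; 3. for every $x\in K$, the map $y\mapsto F(x,y)$ is concave on $D$; 4. $F(x,x)\cap\mathbb{R}_+\neq\emptyset$ for every $x\in D$; 5. there is $r>0$ such that $\{x\in K:\|x\|\le r\}\neq\emptyset$ and, for every $x\in K$ with $\|x\|\le r$, there is $y_0\in D$ with $\|y_0\|<r$ and $F(x,y_0)\subseteq(-\infty,0]$. Then there exists $x_0\in K$ such that $F(x_0,y)\cap\mathbb{R}_+\neq\emptyset$ for all $y\in K$. -/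

import Mathlib

open scoped Pointwise

/-- `U` is self segment-dense in the (convex) set `V`: `U ⊆ V`, `U` is dense in `V`, and for all
`x, y ∈ U` the set `[x, y] ∩ U` is dense in the closed segment `[x, y]`. -/
def SelfSegmentDense {E : Type*} [AddCommGroup E] [Module ℝ E] [TopologicalSpace E]
    (U V : Set E) : Prop :=
  U ⊆ V ∧ V ⊆ closure U ∧
    ∀ x ∈ U, ∀ y ∈ U, segment ℝ x y ⊆ closure (segment ℝ x y ∩ U)

/-- The set-valued map `T` is concave on the (not necessarily convex) set `D`: for every convex
combination `∑ i, c i • p i` of points of `D` that lies in `D`, one has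
`T (∑ i, c i • p i) ⊆ ∑ i, c i • T (p i)`, with Minkowski sums and dilations of sets. -/
def SetValuedConcaveOn {E : Type*} [AddCommGroup E] [Module ℝ E]
    (D : Set E) (T : E → Set ℝ) : Prop :=
  ∀ (n : ℕ) (p : Fin n → E) (c : Fin n → ℝ),
    (∀ i, p i ∈ D) → (∀ i, 0 ≤ c i) → ∑ i, c i = 1 → ∑ i, c i • p i ∈ D →
      T (∑ i, c i • p i) ⊆ ∑ i, c i • T (p i)

/-- A real normed space is reflexive if the canonical map into its bidual is onto. -/
def IsReflexiveSpace (X : Type*) [NormedAddCommGroup X] [NormedSpace ℝ X] : Prop :=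
  Function.Surjective (NormedSpace.inclusionInDoubleDual ℝ X)

/-- `S`, as a subset of `X` with its weak topology. -/
def weakSet {X : Type*} [NormedAddCommGroup X] [NormedSpace ℝ X] (S : Set X) :
    Set (WeakSpace ℝ X) :=
  toWeakSpace ℝ X '' S

/-- The set-valued map `T : K ⇉ ℝ` is upper semicontinuous at `a` for the topology that `K`
inherits from the weak topology of `X`: every open set that contains `T a` contains `T x` for all
`x ∈ K` in some weak neighbourhood of `a`. -/
def WeaklyUpperSemicontinuousAt {X : Type*} [NormedAddCommGroup X] [NormedSpace ℝ X]
    (K : Set X) (T : X → Set ℝ) (a : X) : Prop :=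
  UpperHemicontinuousWithinAt (fun x : WeakSpace ℝ X => T ((toWeakSpace ℝ X).symm x))
    (weakSet K) (toWeakSpace ℝ X a)

/-! For y in D with ‖y‖ ≤ r, let G(y) be the set of points x of K in the ball of radius r at which
F(x, y) has a nonnegative value. By upper semicontinuity in x, G(y) is closed in a weakly compact
set. If x in D is a convex combination of such points y, then F(x, x) has a nonnegative value, and
concavity passes it to some F(x, y). This is the KKM covering condition, but only at points of D.
Self segment-density makes D dense in every polytope with vertices in D, so finite unions of closed
sets that cover the points of D cover the polytope. KKM and compactness then give x₀ in all G(y).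

Coercivity reaches the rest of D: from y₀ with F(x₀, y₀) ≤ 0, move slightly towards y within D. The
nonnegative value found there is a convex combination of a value at y₀ and one at y, so the latter
is nonnegative. Upper semicontinuity in y and density extend this to K.

KKM is derived from Brouwer's theorem on the simplex, which follows from a parity argument of Scarf
type on a grid (`exists_isDominant_image_eq_univ`). -/

/-! ### Scarf's combinatorial lemma -/

/-- `S` is dominant for the family `w` of rankings if no element beats the minimum of `S` in
every ranking. -/
def IsDominant {I V : Type*} (w : I → V → ℕ) (S : Finset V) : Prop :=
  ∀ y, ∃ i, ∀ x ∈ S, w i y ≤ w i x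

theorem IsDominant.mono {I V : Type*} {w : I → V → ℕ} {S T : Finset V} (hS : IsDominant w S)
    (h : T ⊆ S) : IsDominant w T := fun y =>
  let ⟨i, hi⟩ := hS y
  ⟨i, fun x hx => hi x (h hx)⟩

/-- Dominance tested on an element of `S` itself yields a ranking in which that element is the
minimum. So a dominant set consists of its minima and has at most as many elements as there are
rankings. -/
theorem IsDominant.exists_argmin {I V : Type*} [Fintype I] [DecidableEq V] {w : I → V → ℕ}
    (hw : ∀ i, Function.Injective (w i)) {S : Finset V} (hS : IsDominant w S)
    (hne : S.Nonempty) :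
    ∃ a : I → V, (∀ i, a i ∈ S) ∧ (∀ i, ∀ x ∈ S, w i (a i) ≤ w i x) ∧
      Finset.univ.image a = S := by
  choose a ha hmin using fun i => S.exists_min_image (w i) hne
  refine ⟨a, ha, hmin, ?_⟩
  ext x
  simp only [Finset.mem_image, Finset.mem_univ, true_and]
  refine ⟨fun ⟨i, hi⟩ => hi ▸ ha i, fun hx => ?_⟩
  obtain ⟨i, hi⟩ := hS x
  exact ⟨i, hw i (le_antisymm (hmin i x hx) (hi _ (ha i)))⟩

/-- The extensions of a dominant set with one element fewer than there are rankings: for the two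
rankings `p ≠ q` that share their minimum, there is exactly one extension for each of the two sets
`{y | ∀ k ≠ j, w k (a k) < w k y}`, `j = p, q`, that is not empty. -/
theorem IsDominant.exists_extensions {I V : Type*} [Fintype I] [Fintype V] [DecidableEq I]
    [DecidableEq V] {w : I → V → ℕ} (hw : ∀ i, Function.Injective (w i)) {S : Finset V}
    (hS : IsDominant w S) (hne : S.Nonempty) (hcard : S.card + 1 = Fintype.card I) :
    ∃ (a : I → V) (p q : I), (∀ i, a i ∈ S) ∧ (∀ i, ∀ x ∈ S, w i (a i) ≤ w i x) ∧ p ≠ q ∧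
      a p = a q ∧
      (∀ x, (x ∉ S ∧ IsDominant w (insert x S)) ↔ ∃ j, (j = p ∨ j = q) ∧
        (∀ k, k ≠ j → w k (a k) < w k x) ∧
        ∀ y, (∀ k, k ≠ j → w k (a k) < w k y) → w j y ≤ w j x) ∧
      (∀ x, (∀ k, k ≠ p → w k (a k) < w k x) → ¬ ∀ k, k ≠ q → w k (a k) < w k x) := by
  obtain ⟨a, ha, hmin, him⟩ := hS.exists_argmin hw hne
  obtain ⟨p, -, q, -, hpq, hapq⟩ := Finset.exists_ne_map_eq_of_card_lt_of_maps_to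
    (s := Finset.univ) (t := S) (f := a) (by rw [Finset.card_univ]; omega) (fun i _ => ha i)
  have inj : ∀ p q, p ≠ q → a p = a q → Set.InjOn a (Finset.univ.erase p : Finset I) := by
    intro p q hpq hapq
    apply Finset.injOn_of_card_image_eq
    have : (Finset.univ.erase p).image a = S := by
      rw [← him]
      ext x
      simp only [Finset.mem_image, Finset.mem_erase, Finset.mem_univ, and_true, true_and]
      refine ⟨fun ⟨i, _, h⟩ => ⟨i, h⟩, fun ⟨i, h⟩ => ?_⟩
      by_cases hi : i = p
      · exact ⟨q, hpq.symm, by rw [← hapq, ← hi, h]⟩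
      · exact ⟨i, hi, h⟩
    rw [this, Finset.card_erase_of_mem (Finset.mem_univ _), Finset.card_univ]
    omega
  refine ⟨a, p, q, ha, hmin, hpq, hapq, fun x => ⟨?_, ?_⟩, ?_⟩
  · rintro ⟨hx, hdom⟩
    obtain ⟨b, hb, hbmin, hbim⟩ := hdom.exists_argmin hw (Finset.insert_nonempty _ _)
    have hbinj : Function.Injective b := by
      rw [← Set.injOn_univ, ← Finset.coe_univ]
      apply Finset.injOn_of_card_image_eq
      rw [hbim, Finset.card_insert_of_notMem hx, Finset.card_univ, hcard]
    have hxb : x ∈ Finset.univ.image b := by rw [hbim]; exact Finset.mem_insert_self _ _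
    obtain ⟨j, -, hj⟩ := Finset.mem_image.1 hxb
    -- Adding `x` changes the minimum of one ranking only. As `b` is injective, that ranking must be
    -- `p` or `q`.
    have hba : ∀ k, k ≠ j → b k = a k := by
      intro k hk
      have hkx : b k ≠ x := fun h => hk (hbinj (h.trans hj.symm))
      have hkS : b k ∈ S := (Finset.mem_insert.1 (hb k)).resolve_left hkx
      exact hw k (le_antisymm (hbmin k _ (Finset.mem_insert_of_mem (ha k))) (hmin k _ hkS))
    have hM : ∀ k, k ≠ j → w k (a k) < w k x := by
      intro k hk
      refine lt_of_le_of_ne ?_ fun h => ?_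
      · rw [← hba k hk]; exact hbmin k x (Finset.mem_insert_self _ _)
      · exact hx (hw k h ▸ ha k)
    refine ⟨j, ?_, hM, fun y hy => ?_⟩
    · by_contra! h
      exact hpq (hbinj (by rw [hba p h.1.symm, hba q h.2.symm, hapq]))
    · obtain ⟨i, hi⟩ := hdom y
      by_cases hij : i = j
      · exact hij ▸ hi x (Finset.mem_insert_self _ _)
      · exact absurd (hi _ (Finset.mem_insert_of_mem (ha i))) (not_le.2 (hy i hij))
  · rintro ⟨j, hj, hM, hmax⟩
    -- The old minimum of `j` remains the minimum of a second ranking, so the bound at `j'` also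
    -- keeps `x` away from `a j`.
    have hex : ∃ j', j' ≠ j ∧ a j' = a j := by
      rcases hj with rfl | rfl
      · exact ⟨q, hpq.symm, hapq.symm⟩
      · exact ⟨p, hpq, hapq⟩
    obtain ⟨j', hj', haj⟩ := hex
    refine ⟨fun hx => ?_, fun y => ?_⟩
    · rw [← him] at hx
      obtain ⟨k, -, rfl⟩ := Finset.mem_image.1 hx
      have hkj : k = j := by
        by_contra hk
        exact lt_irrefl _ (hM k hk)
      subst hkj
      have := hM j' hj'
      rw [haj] at this
      exact lt_irrefl _ this
    · obtain ⟨i, hi⟩ := hS y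
      -- If a ranking other than `j` bounds `y`, it still does after `x` is added. Otherwise `y`
      -- competes with `x` for the maximum in ranking `j`.
      by_cases h : ∃ i, i ≠ j ∧ ∀ x ∈ S, w i y ≤ w i x
      · obtain ⟨i, hij, hi⟩ := h
        refine ⟨i, fun z hz => ?_⟩
        rcases Finset.mem_insert.1 hz with rfl | hz
        · exact (hi _ (ha i)).trans (hM i hij).le
        · exact hi z hz
      · push Not at h
        have hij : i = j := by
          by_contra hij
          obtain ⟨x, hx, hlt⟩ := h i hij
          exact absurd (hi x hx) (not_le.2 hlt)
        subst hij
        refine ⟨i, fun z hz => ?_⟩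
        rcases Finset.mem_insert.1 hz with rfl | hz
        · refine hmax y fun k hk => ?_
          obtain ⟨x, hx, hlt⟩ := h k hk
          exact (hmin k x hx).trans_lt hlt
        · exact hi z hz
  · intro x h1 h2
    obtain ⟨i, hi⟩ := hS x
    have hlt : w i (a i) < w i x := by
      by_cases hip : i = p
      · exact h2 i (hip ▸ hpq)
      · exact h1 i hip
    exact absurd (hi _ (ha i)) (not_le.2 hlt)

/-- The number of extensions is two if both sets above are nonempty, and one if exactly one is. -/
theorem IsDominant.card_extensions {I V : Type*} [Fintype I] [Fintype V] [DecidableEq I]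
    [DecidableEq V] {w : I → V → ℕ} (hw : ∀ i, Function.Injective (w i)) {d : I → V}
    (hd : Function.Injective d) (hmin : ∀ i v, v ≠ d i → w i (d i) < w i v)
    (hmax : ∀ i j v, j ≠ i → v ∉ Set.range d → w i v < w i (d j)) {S : Finset V}
    (hS : IsDominant w S) (hne : S.Nonempty) (hcard : S.card + 1 = Fintype.card I)
    (E : Finset V) (hE : ∀ x, x ∈ E ↔ x ∉ S ∧ IsDominant w (insert x S)) :
    ((∃ v ∈ S, v ∉ Set.range d) → E.card = 2) ∧
      (∀ l, (∀ i, d i ∈ S ↔ i ≠ l) → (∀ v ∈ S, v ∈ Set.range d) → E.card = 1) := by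
  obtain ⟨a, p, q, ha, hamin, hpq, hapq, hext, hdisj⟩ := hS.exists_extensions hw hne hcard
  have hE' : ∀ x, x ∈ E ↔ ∃ j, (j = p ∨ j = q) ∧ (∀ k, k ≠ j → w k (a k) < w k x) ∧
        ∀ y, (∀ k, k ≠ j → w k (a k) < w k y) → w j y ≤ w j x := fun x => by rw [hE, hext]
  have hmaxi : ∀ j, (∃ y, ∀ k, k ≠ j → w k (a k) < w k y) →
      ∃ x, (∀ k, k ≠ j → w k (a k) < w k x) ∧
        ∀ y, (∀ k, k ≠ j → w k (a k) < w k y) → w j y ≤ w j x := by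
    rintro j ⟨y, hy⟩
    obtain ⟨x, hx, hx'⟩ :=
      (Finset.univ.filter fun x => ∀ k, k ≠ j → w k (a k) < w k x).exists_max_image
        (w j) ⟨y, by simpa using hy⟩
    refine ⟨x, by simpa using hx, fun y hy => hx' y (by simpa using hy)⟩
  constructor
  · rintro ⟨v, hv, hvd⟩
    -- A slack element `d j` exceeds the nonslack `v`, hence the minimum, in every ranking but `j`.
    have hM : ∀ j, ∃ y, ∀ k, k ≠ j → w k (a k) < w k y := fun j =>
      ⟨d j, fun k hk => (hamin k v hv).trans_lt (hmax k j v hk.symm hvd)⟩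
    obtain ⟨x, hx, hx'⟩ := hmaxi p (hM p)
    obtain ⟨y, hy, hy'⟩ := hmaxi q (hM q)
    have hxy : x ≠ y := fun h => hdisj x hx (h ▸ hy)
    rw [← Finset.card_pair hxy]
    congr 1
    ext z
    rw [hE', Finset.mem_insert, Finset.mem_singleton]
    constructor
    · rintro ⟨j, rfl | rfl, hz, hz'⟩
      · exact Or.inl (hw _ (le_antisymm (hx' z hz) (hz' x hx)))
      · exact Or.inr (hw _ (le_antisymm (hy' z hz) (hz' y hy)))
    · rintro (rfl | rfl)
      · exact ⟨p, Or.inl rfl, hx, hx'⟩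
      · exact ⟨q, Or.inr rfl, hy, hy'⟩
  · intro l hl hSd
    have had : ∀ k, k ≠ l → a k = d k := by
      intro k hk
      by_contra h
      exact absurd (hamin k (d k) ((hl k).2 hk)) (not_le.2 (hmin k _ h))
    obtain ⟨m, hml, ham, hpqm⟩ : ∃ m, m ≠ l ∧ a l = d m ∧
        ∀ j, (j = p ∨ j = q) ↔ (j = l ∨ j = m) := by
      by_cases hpl : p = l
      · exact ⟨q, fun h => hpq (hpl.trans h.symm), by
          rw [← hpl, hapq, had q fun h => hpq (hpl.trans h.symm)], fun j => by rw [hpl]⟩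
      · by_cases hql : q = l
        · exact ⟨p, hpl, by rw [← hql, ← hapq, had p hpl], fun j => by rw [hql, or_comm]⟩
        · exact absurd (hd ((had p hpl).symm.trans (hapq.trans (had q hql)))) hpq
    obtain ⟨x, hx, hx'⟩ := hmaxi l ⟨d l, fun k hk => by
      rw [had k hk]
      exact hmin k _ fun h => hk (hd h).symm⟩
    rw [Finset.card_eq_one]
    refine ⟨x, ?_⟩
    ext z
    rw [hE', Finset.mem_singleton]
    constructor
    · rintro ⟨j, hj, hz, hz'⟩
      rcases (hpqm j).1 hj with rfl | rfl
      · exact hw _ (le_antisymm (hx' z hz) (hz' x hx))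
      -- Here the region is empty: `z` exceeds `d j` in ranking `l`, so it is a slack element `d k`
      -- with `k ≠ j`, which cannot exceed `a k` in the ranking `k` that it minimizes.
      · exfalso
        have h1 := hz l hml.symm
        rw [ham] at h1
        by_cases hzd : z ∈ Set.range d
        · obtain ⟨k, rfl⟩ := hzd
          by_cases hk : k = j
          · subst hk
            exact lt_irrefl _ h1
          · have h2 := hz k hk
            have h3 : a k ≠ d k := fun h => lt_irrefl _ (h ▸ h2)
            exact lt_asymm h2 (hmin k _ h3)
        · exact lt_asymm h1 (hmax l j z hml hzd)
    · rintro rfl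
      exact ⟨l, (hpqm l).2 (Or.inl rfl), hx, hx'⟩

/-- A Scarf-type lemma: a coloring of the elements by the rankings, such that the slack elements
`d i` have color `i`, admits a dominant set carrying each color once. -/
theorem exists_isDominant_image_eq_univ {I V : Type*} [Fintype I] [Fintype V] [DecidableEq I]
    [DecidableEq V] {w : I → V → ℕ} (hw : ∀ i, Function.Injective (w i)) {d : I → V}
    (hd : Function.Injective d) (hmin : ∀ i v, v ≠ d i → w i (d i) < w i v)
    (hmax : ∀ i j v, j ≠ i → v ∉ Set.range d → w i v < w i (d j)) (c : V → I)
    (hc : ∀ i, c (d i) = i) (hI : 2 ≤ Fintype.card I) :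
    ∃ S : Finset V, S.card = Fintype.card I ∧ IsDominant w S ∧ S.image c = Finset.univ := by
  classical
  by_contra! hcon
  obtain ⟨l⟩ : Nonempty I := Fintype.card_pos_iff.1 (by omega)
  set rooms : Finset (Finset V) :=
    Finset.univ.filter fun S => S.card = Fintype.card I ∧ IsDominant w S with hrooms
  set doors : Finset (Finset V) := Finset.univ.filter fun S =>
    S.card + 1 = Fintype.card I ∧ IsDominant w S ∧ S.image c = Finset.univ.erase l with hdoors
  have hcinj : ∀ S ∈ doors, Set.InjOn c S := by
    intro S hS
    simp only [hdoors, Finset.mem_filter, Finset.mem_univ, true_and] at hS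
    apply Finset.injOn_of_card_image_eq
    rw [hS.2.2, Finset.card_erase_of_mem (Finset.mem_univ _), Finset.card_univ]
    omega
  have key := Finset.sum_card_bipartiteAbove_eq_sum_card_bipartiteBelow
    (s := doors) (t := rooms) (fun S R => S ⊆ R)
  have hsub : ∀ S ∈ doors, ∀ R ∈ rooms, S ⊆ R → ∃ x, x ∉ S ∧ R = insert x S := by
    intro S hS R hR hSR
    simp only [hdoors, hrooms, Finset.mem_filter, Finset.mem_univ, true_and] at hS hR
    obtain ⟨x, hx, hx'⟩ := Finset.exists_eq_insert_iff.2 ⟨hSR, by omega⟩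
    exact ⟨x, hx, hx'.symm⟩
  -- every room has an even number of doors
  have heven : ∀ R ∈ rooms, Even (Finset.bipartiteBelow (fun S R => S ⊆ R) doors R).card := by
    intro R hR
    rcases Finset.eq_empty_or_nonempty (Finset.bipartiteBelow (fun S R => S ⊆ R) doors R) with h | h
    · simp [h]
    · obtain ⟨S, hS⟩ := h
      rw [Finset.mem_bipartiteBelow] at hS
      obtain ⟨hSd, hSR⟩ := hS
      obtain ⟨x, hxS, rfl⟩ := hsub S hSd R hR hSR
      have hinjS := hcinj S hSd
      have hSd' := hSd
      simp only [hdoors, hrooms, Finset.mem_filter, Finset.mem_univ, true_and] at hSd' hR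
      -- No room has all colors, so `x` repeats the color of some `z` in `S`. The doors of the room
      -- arise by removing `x` or `z`.
      have hcx : c x ∈ S.image c := by
        rw [hSd'.2.2, Finset.mem_erase]
        refine ⟨fun h => hcon _ hR.1 hR.2 ?_, Finset.mem_univ _⟩
        rw [Finset.image_insert, hSd'.2.2, h, Finset.insert_erase (Finset.mem_univ _)]
      obtain ⟨z, hzS, hzx⟩ := Finset.mem_image.1 hcx
      have hxz : x ≠ z := fun h => hxS (h ▸ hzS)
      suffices h : Finset.bipartiteBelow (fun S R => S ⊆ R) doors (insert x S) =
          {S, (insert x S).erase z} by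
        rw [h, Finset.card_pair]
        · exact even_two
        · intro h
          have : z ∈ (insert x S).erase z := h ▸ hzS
          simp at this
      ext U
      rw [Finset.mem_bipartiteBelow, Finset.mem_insert, Finset.mem_singleton]
      constructor
      · rintro ⟨hU, hUS⟩
        have hUinj := hcinj U hU
        have hUR : ∀ y ∈ insert x S, y ∉ U → U = (insert x S).erase y := by
          intro y hy hyU
          refine Finset.eq_of_subset_of_card_le
            (fun u hu => Finset.mem_erase.2 ⟨fun h => hyU (h ▸ hu), hUS hu⟩) ?_
          simp only [hdoors, Finset.mem_filter, Finset.mem_univ, true_and] at hU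
          rw [Finset.card_erase_of_mem hy]
          omega
        by_cases hxU : x ∈ U
        · by_cases hzU : z ∈ U
          · exact absurd (hUinj hxU hzU hzx.symm) hxz
          · exact Or.inr (hUR z (Finset.mem_insert_of_mem hzS) hzU)
        · left
          rw [hUR x (Finset.mem_insert_self _ _) hxU, Finset.erase_insert hxS]
      · rintro (rfl | rfl)
        · exact ⟨hSd, hSR⟩
        · refine ⟨?_, Finset.erase_subset _ _⟩
          simp only [hdoors, Finset.mem_filter, Finset.mem_univ, true_and]
          refine ⟨?_, hR.2.mono (Finset.erase_subset _ _), ?_⟩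
          · rw [Finset.card_erase_of_mem (Finset.mem_insert_of_mem hzS)]
            omega
          · rw [← hSd'.2.2]
            ext k
            simp only [Finset.mem_image, Finset.mem_erase, Finset.mem_insert]
            constructor
            · rintro ⟨y, ⟨hyz, rfl | hy⟩, rfl⟩
              · exact ⟨z, hzS, hzx⟩
              · exact ⟨y, hy, rfl⟩
            · rintro ⟨y, hy, rfl⟩
              by_cases hyz : y = z
              · exact ⟨x, ⟨hxz, Or.inl rfl⟩, by rw [hyz, hzx]⟩
              · exact ⟨y, ⟨hyz, Or.inr hy⟩, rfl⟩
  have hcardE : ∀ S ∈ doors, ∀ E : Finset V, (∀ x, x ∈ E ↔ x ∉ S ∧ IsDominant w (insert x S)) →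
      (Finset.bipartiteAbove (fun S R => S ⊆ R) rooms S).card = E.card := by
    intro S hS E hE
    symm
    refine Finset.card_bij (fun x _ => insert x S) ?_ ?_ ?_
    · intro x hx
      rw [hE] at hx
      rw [Finset.mem_bipartiteAbove]
      refine ⟨?_, Finset.subset_insert _ _⟩
      simp only [hdoors, hrooms, Finset.mem_filter, Finset.mem_univ, true_and] at hS ⊢
      exact ⟨by rw [Finset.card_insert_of_notMem hx.1]; exact hS.1, hx.2⟩
    · intro x hx y _ hxy
      rw [hE] at hx
      exact (Finset.mem_insert.1 (hxy ▸ Finset.mem_insert_self x S)).resolve_right hx.1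
    · intro R hR
      rw [Finset.mem_bipartiteAbove] at hR
      obtain ⟨x, hx, rfl⟩ := hsub S hS R hR.1 hR.2
      have := hR.1
      simp only [hrooms, Finset.mem_filter, Finset.mem_univ, true_and] at this
      exact ⟨x, (hE x).2 ⟨hx, this.2⟩, rfl⟩
  -- The only door with an odd number of rooms: all slack elements but `d l`. Counting incidences
  -- modulo 2 gives the contradiction.
  set S₀ : Finset V := (Finset.univ.erase l).image d with hS₀
  have hS₀mem : ∀ i, d i ∈ S₀ ↔ i ≠ l := by
    intro i
    rw [hS₀, Finset.mem_image]
    refine ⟨fun ⟨j, hj, h⟩ => hd h ▸ (Finset.mem_erase.1 hj).1, fun h =>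
      ⟨i, Finset.mem_erase.2 ⟨h, Finset.mem_univ _⟩, rfl⟩⟩
  have hS₀range : ∀ v ∈ S₀, v ∈ Set.range d := by
    intro v hv
    obtain ⟨i, -, rfl⟩ := Finset.mem_image.1 hv
    exact ⟨i, rfl⟩
  have hS₀door : S₀ ∈ doors := by
    simp only [hdoors, Finset.mem_filter, Finset.mem_univ, true_and]
    refine ⟨?_, fun y => ?_, ?_⟩
    · rw [hS₀, Finset.card_image_of_injective _ hd, Finset.card_erase_of_mem (Finset.mem_univ _),
        Finset.card_univ]
      omega
    · by_cases hy : y ∈ Set.range d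
      · obtain ⟨k, rfl⟩ := hy
        refine ⟨k, fun x _ => ?_⟩
        by_cases hxk : x = d k
        · rw [hxk]
        · exact (hmin k x hxk).le
      · refine ⟨l, fun x hx => ?_⟩
        obtain ⟨i, hi, rfl⟩ := Finset.mem_image.1 hx
        exact (hmax l i y (Finset.mem_erase.1 hi).1 hy).le
    · rw [hS₀, Finset.image_image]
      rw [show c ∘ d = id from funext hc, Finset.image_id]
  have hne : ∀ S ∈ doors, S.Nonempty := by
    intro S hS
    simp only [hdoors, Finset.mem_filter, Finset.mem_univ, true_and] at hS
    exact Finset.card_pos.1 (by omega)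
  have hone : (Finset.bipartiteAbove (fun S R => S ⊆ R) rooms S₀).card = 1 := by
    have hE : ∀ x, x ∈ (Finset.univ.filter fun x => x ∉ S₀ ∧ IsDominant w (insert x S₀)) ↔
        x ∉ S₀ ∧ IsDominant w (insert x S₀) := by simp
    rw [hcardE S₀ hS₀door _ hE]
    have h := hS₀door
    simp only [hdoors, Finset.mem_filter, Finset.mem_univ, true_and] at h
    exact (h.2.1.card_extensions hw hd hmin hmax (hne _ hS₀door) h.1 _ hE).2 l hS₀mem hS₀range
  have htwo : ∀ S ∈ doors.erase S₀,
      Even (Finset.bipartiteAbove (fun S R => S ⊆ R) rooms S).card := by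
    intro S hS
    obtain ⟨hSS₀, hS⟩ := Finset.mem_erase.1 hS
    have hE : ∀ x, x ∈ (Finset.univ.filter fun x => x ∉ S ∧ IsDominant w (insert x S)) ↔
        x ∉ S ∧ IsDominant w (insert x S) := by simp
    rw [hcardE S hS _ hE]
    have h := hS
    simp only [hdoors, Finset.mem_filter, Finset.mem_univ, true_and] at h
    rw [(h.2.1.card_extensions hw hd hmin hmax (hne _ hS) h.1 _ hE).1 ?_]
    · exact even_two
    · by_contra! hall
      apply hSS₀
      have hcard : S₀.card = S.card := by
        have h' := hS₀door
        simp only [hdoors, Finset.mem_filter, Finset.mem_univ, true_and] at h'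
        omega
      refine Finset.eq_of_subset_of_card_le (fun v hv => ?_) hcard.le
      obtain ⟨i, rfl⟩ := hall v hv
      rw [hS₀mem]
      have : c (d i) ∈ S.image c := Finset.mem_image_of_mem c hv
      rw [h.2.2, hc] at this
      exact (Finset.mem_erase.1 this).1
  rw [← Finset.add_sum_erase _ _ hS₀door, hone] at key
  have h1 := Finset.even_sum _ heven
  rw [← key] at h1
  have h2 := Finset.even_sum _ htwo
  rw [Nat.even_add] at h1
  exact Nat.not_even_one (h1.2 h2)

/-! ### Colorings of a grid in the simplex -/

/-- The Scarf-type lemma on the grid of points of `I → ℕ` with coordinate sum `N`. -/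
theorem exists_grid_dominant {I : Type*} [Fintype I] (hI : 2 ≤ Fintype.card I) (N : ℕ)
    (c : (I → ℕ) → I) :
    ∃ (C : Finset I) (S : Finset (I → ℕ)), (∀ x ∈ S, ∑ i, x i = N) ∧ C.Nonempty ∧
      (∀ i ∈ C, ∃ x ∈ S, c x = i) ∧ ∀ y : I → ℕ, ∑ i, y i = N → ∃ i ∈ C, ∀ x ∈ S, y i ≤ x i := by
  classical
  let T := {x // x ∈ Finset.piAntidiag (Finset.univ : Finset I) N}
  have hT : ∀ x : T, ∑ i, x.1 i = N := fun x => (Finset.mem_piAntidiag.1 x.2).1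
  have hle : ∀ (x : T) i, x.1 i ≤ N := fun x i => by
    refine le_of_le_of_eq ?_ (hT x)
    exact Finset.single_le_sum (fun _ _ => Nat.zero_le _) (Finset.mem_univ i)
  let e : T ≃ Fin (Fintype.card T) := Fintype.equivFin T
  let e' : I ≃ Fin (Fintype.card I) := Fintype.equivFin I
  let M := Fintype.card T
  -- Grid points are ranked by coordinate `i`, ties broken by an enumeration. The shift by 1 leaves
  -- rank 0 to the slack element `i`; the other slack elements go above all grid points.
  let w : I → T ⊕ I → ℕ := fun i => Sum.elim (fun x => x.1 i * M + e x + 1)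
    fun j => if j = i then 0 else N * M + M + 1 + e' j
  have he : ∀ x, (e x : ℕ) < M := fun x => (e x).2
  have hwl : ∀ i x, w i (Sum.inl x) < N * M + M + 1 := by
    intro i x
    have h1 := he x
    have h2 := Nat.mul_le_mul_right M (hle x i)
    simp only [w, Sum.elim_inl]
    omega
  have hinj : ∀ i, Function.Injective (w i) := by
    rintro i (x | x) (y | y) h
    · simp only [w, Sum.elim_inl, add_left_inj] at h
      have h' := congrArg (· % M) h
      simp only [Nat.mul_add_mod_self_right, Nat.mod_eq_of_lt (he _)] at h'
      rw [e.injective (Fin.ext h')]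
    · have := hwl i x
      rw [h] at this
      simp only [w, Sum.elim_inr, Sum.elim_inl] at h this
      split_ifs at h this
      omega
    · have := hwl i y
      rw [← h] at this
      simp only [w, Sum.elim_inr, Sum.elim_inl] at h this
      split_ifs at h this
      omega
    · simp only [w, Sum.elim_inr] at h
      split_ifs at h with h1 h2 h2
      · rw [h1, h2]
      · omega
      · omega
      · have hxy : (e' x : ℕ) = e' y := by omega
        rw [e'.injective (Fin.ext hxy)]
  obtain ⟨R, -, hR, hcol⟩ := exists_isDominant_image_eq_univ (w := w) hinj (d := Sum.inr)
    Sum.inr_injective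
    (by
      rintro i (x | j) h
      · simp [w]
      · have : j ≠ i := fun h' => h (h' ▸ rfl)
        simp only [w, Sum.elim_inr, if_true, if_neg this]
        omega)
    (by
      rintro i j (x | k) hj hv
      · refine (hwl i x).trans_le ?_
        simp only [w, Sum.elim_inr, if_neg hj]
        omega
      · exact absurd ⟨k, rfl⟩ hv)
    (Sum.elim (fun x => c x.1) id) (fun i => rfl) hI
  have hdom : ∀ y : I → ℕ, ∑ i, y i = N →
      ∃ i, Sum.inr i ∉ R ∧ ∀ x : T, Sum.inl x ∈ R → y i ≤ x.1 i := by
    intro y hy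
    let y' : T := ⟨y, Finset.mem_piAntidiag.2 ⟨hy, fun i _ => Finset.mem_univ i⟩⟩
    obtain ⟨i, hi⟩ := hR (Sum.inl y')
    refine ⟨i, fun h => ?_, fun x hx => ?_⟩
    · have := hi _ h
      simp [w] at this
    · have h1 := hi _ hx
      have h2 := he x
      simp only [w, Sum.elim_inl] at h1
      by_contra! h3
      have h4 := Nat.mul_le_mul_right M (Nat.succ_le_of_lt h3)
      rw [Nat.succ_mul] at h4
      change y i * M + _ + 1 ≤ _ at h1
      omega
  refine ⟨Finset.univ.filter fun i => Sum.inr i ∉ R,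
    (Finset.univ.filter fun x : T => Sum.inl x ∈ R).image Subtype.val, ?_, ?_, ?_, ?_⟩
  · intro x hx
    obtain ⟨x, -, rfl⟩ := Finset.mem_image.1 hx
    exact hT x
  · obtain ⟨l⟩ : Nonempty I := Fintype.card_pos_iff.1 (by omega)
    obtain ⟨i, hi, -⟩ := hdom (Pi.single l N) (by simp)
    exact ⟨i, by simpa using hi⟩
  · intro i hi
    simp only [Finset.mem_filter, Finset.mem_univ, true_and] at hi
    have : i ∈ R.image (Sum.elim (fun x => c x.1) id) := by
      rw [hcol]
      exact Finset.mem_univ i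
    obtain ⟨x | j, hx, h⟩ := Finset.mem_image.1 this
    · exact ⟨x.1, Finset.mem_image_of_mem _ (by simpa using hx), h⟩
    · have hji : j = i := h
      subst hji
      exact absurd hx hi
  · intro y hy
    obtain ⟨i, hi, hi'⟩ := hdom y hy
    refine ⟨i, by simpa using hi, fun x hx => ?_⟩
    obtain ⟨x, hx, rfl⟩ := Finset.mem_image.1 hx
    exact hi' x (by simpa using hx)

/-- Every coloring of the grid has a small cluster of points such that every coordinate is either
small on the cluster or the color of one of its points. -/
theorem exists_grid_cluster {I : Type*} [Fintype I] (hI : 2 ≤ Fintype.card I) (N : ℕ)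
    (c : (I → ℕ) → I) :
    ∃ p : I → ℕ, ∑ i, p i = N ∧ ∀ i, p i ≤ Fintype.card I ∨ ∃ x : I → ℕ, ∑ i, x i = N ∧ c x = i ∧
      ∀ k, x k ≤ p k + Fintype.card I ∧ p k ≤ x k + Fintype.card I := by
  classical
  obtain ⟨C, S, hS, ⟨l, hl⟩, hC, hdom⟩ := exists_grid_dominant hI N c
  obtain ⟨p, hp, -⟩ := hC l hl
  choose z hz hzmin using fun i => S.exists_min_image (fun x => x i) ⟨p, hp⟩
  have hsum : N < ∑ i ∈ C, (z i i + 1) := by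
    by_contra! h
    -- If the minima had room to spare, this grid point would exceed each of them by at least 1; the
    -- surplus is put on coordinate `l`.
    let y : I → ℕ := fun i => (if i ∈ C then z i i + 1 else 0) +
      if i = l then N - ∑ i ∈ C, (z i i + 1) else 0
    obtain ⟨i, hi, hi'⟩ := hdom y (by
      simp only [y, Finset.sum_add_distrib, Finset.sum_ite_mem, Finset.univ_inter,
        Finset.sum_ite_eq', Finset.mem_univ, if_true]
      rw [← Finset.sum_add_distrib]
      omega)
    have := hi' _ (hz i)
    simp only [y, if_pos hi] at this
    omega
  rw [Finset.sum_add_distrib, Finset.sum_const, smul_eq_mul, mul_one] at hsum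
  have hCcard : C.card ≤ Fintype.card I := Finset.card_le_univ C
  have hin : ∀ x ∈ S, ∀ i ∈ C, z i i ≤ x i ∧ x i ≤ z i i + Fintype.card I := by
    intro x hx i hi
    refine ⟨hzmin i x hx, ?_⟩
    have h1 : ∑ j ∈ C, x j ≤ N := by
      rw [← hS x hx]
      exact Finset.sum_le_sum_of_subset (Finset.subset_univ _)
    have h2 : ∑ j ∈ C.erase i, z j j ≤ ∑ j ∈ C.erase i, x j :=
      Finset.sum_le_sum fun j _ => hzmin j x hx
    rw [← Finset.add_sum_erase _ _ hi] at h1 hsum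
    omega
  have hout : ∀ x ∈ S, ∀ i, i ∉ C → x i ≤ Fintype.card I := by
    intro x hx i hi
    have h1 : x i + ∑ j ∈ C, x j ≤ N := by
      rw [← hS x hx, ← Finset.sum_insert hi]
      exact Finset.sum_le_sum_of_subset (Finset.subset_univ _)
    have h2 : ∑ j ∈ C, z j j ≤ ∑ j ∈ C, x j := Finset.sum_le_sum fun j _ => hzmin j x hx
    omega
  refine ⟨p, hS p hp, fun i => ?_⟩
  by_cases hi : i ∈ C
  · obtain ⟨x, hx, hcx⟩ := hC i hi
    refine Or.inr ⟨x, hS x hx, hcx, fun k => ?_⟩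
    by_cases hk : k ∈ C
    · have h1 := hin x hx k hk
      have h2 := hin p hp k hk
      omega
    · have h1 := hout x hx k hk
      have h2 := hout p hp k hk
      omega
  · exact Or.inl (hout p hp i hi)

/-! ### Brouwer's theorem and the KKM lemma -/

/-- Brouwer's fixed point theorem on the standard simplex, for maps into the simplex that are given
on the whole space of coordinates. -/
theorem exists_fixedPoint_stdSimplex {I : Type*} [Fintype I] (hI : 2 ≤ Fintype.card I)
    {f : (I → ℝ) → I → ℝ} (hf : ContinuousOn f (stdSimplex ℝ I))
    (hmaps : Set.MapsTo f (stdSimplex ℝ I) (stdSimplex ℝ I)) :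
    ∃ x ∈ stdSimplex ℝ I, f x = x := by
  classical
  have hne : Nonempty I := Fintype.card_pos_iff.1 (by omega)
  -- A point with `x i ≤ f x i` for all `i` is fixed, since both coordinate sums are 1; compactness
  -- yields one from approximate ones.
  suffices h : ∀ ε > 0, ∃ x ∈ stdSimplex ℝ I, ∀ i, x i - ε ≤ f x i by
    have hcomp := isCompact_stdSimplex ℝ I
    have hcont : ContinuousOn (fun x => ∑ i, max (x i - f x i) 0) (stdSimplex ℝ I) := by
      refine continuousOn_finsetSum _ fun i _ => ?_
      refine ContinuousOn.sup ?_ continuousOn_const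
      exact (continuous_apply i).continuousOn.sub ((continuous_apply i).comp_continuousOn hf)
    obtain ⟨x₀, hx₀, -⟩ := h 1 one_pos
    obtain ⟨x, hx, hmin⟩ := hcomp.exists_isMinOn ⟨x₀, hx₀⟩ hcont
    have hle : ∀ i, x i ≤ f x i := by
      intro i
      by_contra! hlt
      have hpos : 0 < ∑ i, max (x i - f x i) 0 :=
        Finset.sum_pos' (fun _ _ => le_max_right _ _)
          ⟨i, Finset.mem_univ i, lt_max_of_lt_left (sub_pos.2 hlt)⟩
      set m := ∑ i, max (x i - f x i) 0
      have hcard : (0 : ℝ) < Fintype.card I := by exact_mod_cast Fintype.card_pos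
      obtain ⟨y, hy, hyf⟩ := h (m / (2 * Fintype.card I)) (by positivity)
      have h1 : m ≤ ∑ i, max (y i - f y i) 0 := hmin hy
      have h2 : ∑ i, max (y i - f y i) 0 ≤ ∑ _i : I, m / (2 * Fintype.card I) :=
        Finset.sum_le_sum fun i _ => max_le (by linarith [hyf i]) (by positivity)
      rw [Finset.sum_const, Finset.card_univ, nsmul_eq_mul] at h2
      have h3 : (Fintype.card I : ℝ) * (m / (2 * Fintype.card I)) = m / 2 := by field_simp
      linarith
    refine ⟨x, hx, ?_⟩
    have heq := (Finset.sum_eq_sum_iff_of_le fun i _ => hle i).1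
      (hx.2.trans (hmaps hx).2.symm)
    exact funext fun i => (heq i (Finset.mem_univ i)).symm
  intro ε hε
  have hunif := (isCompact_stdSimplex ℝ I).uniformContinuousOn_of_continuous hf
  rw [Metric.uniformContinuousOn_iff] at hunif
  obtain ⟨δ, hδ, hδf⟩ := hunif (ε / 2) (half_pos hε)
  set n : ℝ := (Fintype.card I : ℝ) with hn
  obtain ⟨N, hN⟩ := exists_nat_gt (n / min δ (ε / 2))
  have hmpos : 0 < min δ (ε / 2) := lt_min hδ (half_pos hε)
  have hnpos : 0 ≤ n := Nat.cast_nonneg _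
  have hNpos : (0 : ℝ) < N := (div_nonneg hnpos hmpos.le).trans_lt hN
  have hnN : n / N < min δ (ε / 2) := by
    rw [div_lt_iff₀ hmpos] at hN
    rw [div_lt_iff₀ hNpos]
    linarith
  let g : (I → ℕ) → I → ℝ := fun x i => x i / N
  have hg : ∀ x : I → ℕ, ∑ i, x i = N → g x ∈ stdSimplex ℝ I := by
    intro x hx
    refine ⟨fun i => by positivity, ?_⟩
    simp only [g]
    rw [← Finset.sum_div, ← Nat.cast_sum, hx, div_self hNpos.ne']
  -- A grid point is colored by a coordinate that `f` does not decrease; points off the grid get an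
  -- arbitrary color.
  have hex : ∀ x : I → ℕ, ∃ i, ∑ i, x i = N → g x i ≤ f (g x) i := by
    intro x
    by_contra! h
    have h1 : ∑ i, f (g x) i < ∑ i, g x i :=
      Finset.sum_lt_sum_of_nonempty Finset.univ_nonempty fun i _ => (h i).2
    have hx : ∑ i, x i = N := (h hne.some).1
    rw [(hmaps (hg x hx)).2, (hg x hx).2] at h1
    exact lt_irrefl _ h1
  choose c hc using hex
  obtain ⟨p, hp, hpi⟩ := exists_grid_cluster hI N c
  refine ⟨g p, hg p hp, fun i => ?_⟩
  rcases hpi i with h | ⟨x, hx, hcx, hclose⟩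
  · have h1 : g p i ≤ n / N := by
      simp only [g]
      gcongr
      rw [hn]
      exact_mod_cast h
    have h2 := (hmaps (hg p hp)).1 i
    have h3 := min_le_right δ (ε / 2)
    linarith
  · have hd : ∀ k, |g p k - g x k| ≤ n / N := by
      intro k
      simp only [g]
      rw [← sub_div, abs_div, abs_of_pos hNpos]
      gcongr
      have h1 : (x k : ℝ) ≤ p k + n := by
        rw [hn]
        exact_mod_cast (hclose k).1
      have h2 : (p k : ℝ) ≤ x k + n := by
        rw [hn]
        exact_mod_cast (hclose k).2
      rw [abs_le]
      constructor <;> linarith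
    have hdist : dist (g p) (g x) < δ :=
      ((dist_pi_le_iff (by positivity)).2 fun k => by rw [Real.dist_eq]; exact hd k).trans_lt
        (hnN.trans_le (min_le_left _ _))
    have h1 := (dist_le_pi_dist _ _ i).trans_lt (hδf _ (hg p hp) _ (hg x hx) hdist)
    rw [Real.dist_eq, abs_lt] at h1
    have h2 := hc x hx
    rw [hcx] at h2
    have h3 := (abs_le.1 (hd i)).2
    have h4 := hnN.trans_le (min_le_right _ _)
    linarith [h1.1]

/-- The Knaster–Kuratowski–Mazurkiewicz lemma. -/
theorem exists_mem_stdSimplex_forall_mem {I : Type*} [Fintype I] [Nonempty I] {A : I → Set (I → ℝ)}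
    (hA : ∀ i, IsClosed (A i)) (h : ∀ x ∈ stdSimplex ℝ I, ∃ i, 0 < x i ∧ x ∈ A i) :
    ∃ x ∈ stdSimplex ℝ I, ∀ i, x ∈ A i := by
  classical
  rcases Nat.lt_or_ge (Fintype.card I) 2 with hI | hI
  · have : Subsingleton I := Fintype.card_le_one_iff_subsingleton.1 (by omega)
    obtain ⟨l⟩ := ‹Nonempty I›
    obtain ⟨i, -, hi⟩ := h _ (single_mem_stdSimplex ℝ l)
    exact ⟨_, single_mem_stdSimplex ℝ l, fun j => Subsingleton.elim i j ▸ hi⟩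
  -- `Metric.infDist` to the empty set is 0, so zero distance gives membership only for nonempty
  -- sets.
  have hAne : ∀ i, (A i).Nonempty := by
    intro i
    obtain ⟨j, hj, hj'⟩ := h _ (single_mem_stdSimplex ℝ i)
    have : j = i := by
      by_contra hne
      simp [hne] at hj
    exact ⟨_, this ▸ hj'⟩
  let s : (I → ℝ) → ℝ := fun x => ∑ i, Metric.infDist x (A i)
  have hs : ∀ x, 0 ≤ s x := fun x => Finset.sum_nonneg fun i _ => Metric.infDist_nonneg
  have hscont : Continuous s := continuous_finsetSum _ fun i _ => Metric.continuous_infDist_pt _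
  have hpos : ∀ x, 0 < 1 + s x := fun x => by linarith [hs x]
  -- At a fixed point each distance is `x i * s x`. The covering provides an `i` with `x i > 0` and
  -- distance 0, so `s x = 0`.
  obtain ⟨x, hx, hfx⟩ := exists_fixedPoint_stdSimplex hI
    (f := fun x i => (x i + Metric.infDist x (A i)) / (1 + s x))
    (by
      refine Continuous.continuousOn (continuous_pi fun i => ?_)
      exact ((continuous_apply i).add (Metric.continuous_infDist_pt _)).div
        (continuous_const.add hscont) fun x => (hpos x).ne')
    (by
      intro x hx
      refine ⟨fun i => div_nonneg (add_nonneg (hx.1 i) Metric.infDist_nonneg) (hpos x).le, ?_⟩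
      rw [← Finset.sum_div, Finset.sum_add_distrib, hx.2, div_self (hpos x).ne'])
  have heq : ∀ i, Metric.infDist x (A i) = x i * s x := by
    intro i
    have := congrFun hfx i
    rw [div_eq_iff (hpos x).ne'] at this
    linarith
  obtain ⟨i, hi, hxi⟩ := h x hx
  have h0 : s x = 0 := by
    have := heq i
    rw [Metric.infDist_zero_of_mem hxi] at this
    exact (mul_eq_zero.1 this.symm).resolve_left hi.ne'
  refine ⟨x, hx, fun j => ?_⟩
  rw [(hA j).mem_iff_infDist_zero (hAne j), heq j, h0, mul_zero]

/-! ### KKM over self segment-dense sets -/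

/-- If `D` meets every segment between its points densely, then it meets every polytope with
vertices in `D` densely. -/
theorem convexHull_subset_closure_inter {E : Type*} [AddCommGroup E] [Module ℝ E]
    [TopologicalSpace E] [ContinuousAdd E] [ContinuousConstSMul ℝ E] {D : Set E}
    (hD : ∀ x ∈ D, ∀ y ∈ D, segment ℝ x y ⊆ closure (segment ℝ x y ∩ D)) {s : Set E}
    (hs : s.Finite) (hsD : s ⊆ D) : convexHull ℝ s ⊆ closure (convexHull ℝ s ∩ D) := by
  induction s, hs using Set.Finite.induction_on with
  | empty => simp
  | @insert a s _ _ ih =>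
    have haD : a ∈ D := hsD (Set.mem_insert a s)
    rcases s.eq_empty_or_nonempty with rfl | hne
    · rw [insert_empty_eq, convexHull_singleton, Set.singleton_subset_iff]
      exact subset_closure ⟨rfl, haD⟩
    intro z hz
    have hz' := hz
    rw [convexHull_insert hne, convexJoin_singleton_left, Set.mem_iUnion₂] at hz'
    obtain ⟨b, hb, α, β, hα, hβ, hαβ, rfl⟩ := hz'
    have hcont : Continuous fun v : E => α • a + β • v := by fun_prop
    have h1 := image_closure_subset_closure_image hcont
      ⟨b, ih ((Set.subset_insert a s).trans hsD) hb, rfl⟩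
    refine closure_minimal ?_ isClosed_closure h1
    rintro _ ⟨v, ⟨hv, hvD⟩, rfl⟩
    refine closure_mono (Set.inter_subset_inter_left D ?_)
      (hD a haD v hvD ⟨α, β, hα, hβ, hαβ, rfl⟩)
    exact (convex_convexHull ℝ _).segment_subset
      (subset_convexHull ℝ _ (Set.mem_insert a s))
      (convexHull_mono (Set.subset_insert a s) hv)

/-- The KKM principle in a topological vector space, where the covering condition is only required
at the points of a self segment-dense set. -/
theorem exists_mem_convexHull_forall_mem {E : Type*} [AddCommGroup E] [Module ℝ E]
    [TopologicalSpace E] [ContinuousAdd E] [ContinuousSMul ℝ E] {D : Set E}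
    (hD : ∀ x ∈ D, ∀ y ∈ D, segment ℝ x y ⊆ closure (segment ℝ x y ∩ D)) {ι : Type*} [Fintype ι]
    [Nonempty ι] {y : ι → E} (hy : ∀ i, y i ∈ D) {G : ι → Set E} (hG : ∀ i, IsClosed (G i))
    (h : ∀ J : Finset ι, ∀ x ∈ convexHull ℝ (y '' J), x ∈ D → ∃ i ∈ J, x ∈ G i) :
    ∃ x ∈ convexHull ℝ (Set.range y), ∀ i, x ∈ G i := by
  classical
  let φ : (ι → ℝ) → E := fun c => ∑ i, c i • y i
  have hφ : Continuous φ := by fun_prop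
  have hcover : ∀ J : Finset ι, ∀ x ∈ convexHull ℝ (y '' J), ∃ i ∈ J, x ∈ G i := by
    intro J x hx
    have hcl : IsClosed (⋃ i ∈ J, G i) := J.finite_toSet.isClosed_biUnion fun i _ => hG i
    have hx' := convexHull_subset_closure_inter hD (J.finite_toSet.image y)
      (by rintro _ ⟨i, -, rfl⟩; exact hy i) hx
    have := closure_minimal (fun z hz => by simpa using h J z hz.1 hz.2) hcl hx'
    simpa using this
  obtain ⟨c, hc, hcA⟩ := exists_mem_stdSimplex_forall_mem (A := fun i => φ ⁻¹' G i)
    (fun i => (hG i).preimage hφ) (by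
      intro c hc
      -- Restricting to the support of `c` ensures that the index given by the covering has positive
      -- weight.
      have hsum : φ c = ∑ i ∈ Finset.univ.filter fun i => 0 < c i, c i • y i := by
        refine (Finset.sum_subset (Finset.subset_univ _) fun i _ hi => ?_).symm
        rw [le_antisymm (by simpa using hi) (hc.1 i), zero_smul]
      have hone : ∑ i ∈ Finset.univ.filter fun i => 0 < c i, c i = 1 := by
        rw [← hc.2]
        refine Finset.sum_subset (Finset.subset_univ _) fun i _ hi => ?_
        exact le_antisymm (by simpa using hi) (hc.1 i)
      obtain ⟨i, hi, hi'⟩ := hcover (Finset.univ.filter fun i => 0 < c i) (φ c) (by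
        rw [hsum]
        exact (convex_convexHull ℝ _).sum_mem (fun i _ => hc.1 i) hone fun i hi =>
          subset_convexHull ℝ _ ⟨i, hi, rfl⟩)
      exact ⟨i, (Finset.mem_filter.1 hi).2, hi'⟩)
  exact ⟨φ c, (convex_convexHull ℝ _).sum_mem (fun i _ => hc.1 i) hc.2 fun i _ =>
    subset_convexHull ℝ _ ⟨i, rfl⟩, hcA⟩

/-! ### Concavity, weak compactness and semicontinuity -/

/-- A set-valued map that is concave on `D` and has a nonnegative value at a convex combination
in `D` has a nonnegative value at one of the points that are combined. -/
theorem SetValuedConcaveOn.exists_nonneg {E : Type*} [AddCommGroup E] [Module ℝ E] {D : Set E}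
    {T : E → Set ℝ} (hT : SetValuedConcaveOn D T) {s : Finset E} (hs : (s : Set E) ⊆ D) {x : E}
    (hx : x ∈ convexHull ℝ (s : Set E)) (hxD : x ∈ D) (hTx : (T x ∩ Set.Ici 0).Nonempty) :
    ∃ y ∈ s, (T y ∩ Set.Ici 0).Nonempty := by
  obtain ⟨c, hc, hc1, rfl⟩ := Finset.mem_convexHull'.1 hx
  let e := s.equivFin
  have hsum : ∀ g : E → E, ∑ i, g (e.symm i) = ∑ y ∈ s, g y := fun g => by
    rw [Equiv.sum_comp e.symm fun y : s => g y, Finset.sum_coe_sort]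
  have hsumR : ∀ g : E → ℝ, ∑ i, g (e.symm i) = ∑ y ∈ s, g y := fun g => by
    rw [Equiv.sum_comp e.symm fun y : s => g y, Finset.sum_coe_sort]
  have hsub := hT _ (fun i => (e.symm i : E)) (fun i => c (e.symm i)) (fun i => hs (e.symm i).2)
    (fun i => hc _ (e.symm i).2) (by rw [hsumR c, hc1]) (by rwa [hsum fun y => c y • y])
  rw [hsum fun y => c y • y] at hsub
  obtain ⟨v, hv, hv0⟩ := hTx
  obtain ⟨g, hg, hgv⟩ := Set.mem_finsetSum (t := Finset.univ) _ v |>.1 (hsub hv)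
  by_contra! hneg
  -- Terms of weight 0 vanish, so strict negativity of the sum needs a positive weight.
  have hb : ∀ i, 0 ≤ c (e.symm i) ∧ (g i ≤ 0 ∧ (0 < c (e.symm i) → g i < 0)) := by
    intro i
    obtain ⟨b, hb, hbg⟩ := hg (Finset.mem_univ i)
    have hb0 : b < 0 := by
      by_contra! h
      exact (hneg _ (e.symm i).2).subset ⟨hb, h⟩
    have hci := hc _ (e.symm i).2
    simp only [smul_eq_mul] at hbg
    rw [← hbg]
    exact ⟨hci, mul_nonpos_of_nonneg_of_nonpos hci hb0.le, fun h => mul_neg_of_pos_of_neg h hb0⟩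
  obtain ⟨i, hi⟩ : ∃ i, 0 < c (e.symm i) := by
    by_contra! h
    have h1 : ∑ i, c (e.symm i) ≤ 0 := Finset.sum_nonpos fun i _ => h i
    rw [hsumR c, hc1] at h1
    linarith
  have : ∑ i, g i < 0 :=
    Finset.sum_neg' (fun i _ => (hb i).2.1) ⟨i, Finset.mem_univ i, (hb i).2.2 hi⟩
  rw [hgv] at this
  exact absurd hv0 (not_le.2 this)

/-- In a reflexive space, bounded closed convex sets are weakly compact. -/
theorem IsReflexiveSpace.isCompact_weakSet {X : Type*} [NormedAddCommGroup X] [NormedSpace ℝ X]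
    (hX : IsReflexiveSpace X) {S : Set X} (hconv : Convex ℝ S) (hclosed : IsClosed S)
    (hb : Bornology.IsBounded S) : IsCompact (weakSet S) := by
  have h := hconv.toWeakSpace_closure ℝ
  rw [hclosed.closure_eq] at h
  rw [weakSet, h]
  refine NormedSpace.isCompact_closure_of_isBounded ℝ X _ ?_ ?_
  · rwa [Set.preimage_image_eq _ (toWeakSpace ℝ X).injective]
  · intro z _
    obtain ⟨x, hx⟩ := hX z
    exact ⟨toWeakSpace ℝ X x, hx⟩

/-- Having no nonnegative value means lying in the open half-line `Set.Iio 0`, which is the open set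
used in the definition. -/
theorem WeaklyUpperSemicontinuousAt.eventually_subset {X : Type*} [NormedAddCommGroup X]
    [NormedSpace ℝ X] {K : Set X} {T : X → Set ℝ} {a : X}
    (h : WeaklyUpperSemicontinuousAt K T a) (hneg : ¬ (T a ∩ Set.Ici 0).Nonempty) :
    ∀ᶠ x in nhdsWithin (toWeakSpace ℝ X a) (weakSet K),
      ¬ (T ((toWeakSpace ℝ X).symm x) ∩ Set.Ici 0).Nonempty := by
  have hsub : T a ⊆ Set.Iio 0 := fun v hv => lt_of_not_ge fun h0 : 0 ≤ v => hneg ⟨v, hv, h0⟩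
  have h' : UpperHemicontinuousWithinAt
      (fun x : WeakSpace ℝ X => T ((toWeakSpace ℝ X).symm x)) (weakSet K) (toWeakSpace ℝ X a) := h
  filter_upwards [h'.forall_isOpen _ isOpen_Iio hsub] with x hx
  rintro ⟨v, hv, h0⟩
  exact absurd (Set.mem_Iio.1 (hx hv)) (not_lt.2 h0)

/-- The points of a bounded closed convex part of `K` at which an upper semicontinuous map has a
nonnegative value form a weakly closed set. -/
theorem isClosed_weakSet_inter_nonneg {X : Type*} [NormedAddCommGroup X] [NormedSpace ℝ X]
    {K S : Set X} (hconv : Convex ℝ S) (hclosed : IsClosed S) (hSK : S ⊆ K) {T : X → Set ℝ}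
    (hT : ∀ a ∈ K, WeaklyUpperSemicontinuousAt K T a) :
    IsClosed (weakSet {x ∈ S | (T x ∩ Set.Ici 0).Nonempty}) := by
  have hS := hconv.toWeakSpace_closure ℝ
  rw [hclosed.closure_eq] at hS
  refine isClosed_of_closure_subset fun z hz => ?_
  have hzS : z ∈ toWeakSpace ℝ X '' S := by
    rw [hS]
    exact closure_mono (Set.image_mono fun x hx => hx.1) hz
  obtain ⟨a, ha, rfl⟩ := hzS
  refine ⟨a, ⟨ha, ?_⟩, rfl⟩
  by_contra hneg
  have hev := (hT a (hSK ha)).eventually_subset hneg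
  rw [eventually_nhdsWithin_iff] at hev
  obtain ⟨_, hx, ⟨x, hx', rfl⟩⟩ := mem_closure_iff_nhds.1 hz _ hev
  exact hx ⟨x, hSK hx'.1, rfl⟩ (by simpa using hx'.2)

/-- Near its first end point, a segment with end points in a weakly self segment-dense set contains
points of that set other than the end point. -/
theorem exists_mem_combination_norm_le {X : Type*} [NormedAddCommGroup X] [NormedSpace ℝ X]
    {D : Set X} {u v : X} (huv : u ≠ v)
    (hD : segment ℝ (toWeakSpace ℝ X u) (toWeakSpace ℝ X v) ⊆
      closure (segment ℝ (toWeakSpace ℝ X u) (toWeakSpace ℝ X v) ∩ weakSet D)) {r : ℝ}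
    (hu : ‖u‖ < r) :
    ∃ a b : ℝ, 0 ≤ a ∧ 0 < b ∧ a + b = 1 ∧ a • u + b • v ∈ D ∧ ‖a • u + b • v‖ ≤ r := by
  -- Weak density does not by itself control the norm. A functional separating `u` and `v` is
  -- strictly monotone along the segment, so the weakly open strip used below is exactly `0 < b < t`
  -- there, and `t` is small enough for the norm bound.
  obtain ⟨f, hf⟩ := geometric_hahn_banach_point_point huv
  have hpos : 0 < ‖v - u‖ := norm_pos_iff.2 (sub_ne_zero.2 huv.symm)
  obtain ⟨t, ht, ht1, htr⟩ : ∃ t : ℝ, 0 < t ∧ t ≤ 1 ∧ t * ‖v - u‖ ≤ r - ‖u‖ := by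
    refine ⟨min 1 ((r - ‖u‖) / ‖v - u‖), lt_min one_pos (div_pos (sub_pos.2 hu) hpos),
      min_le_left _ _, ?_⟩
    rw [← le_div_iff₀ hpos]
    exact min_le_right _ _
  have hfc : Continuous fun w : WeakSpace ℝ X => f ((toWeakSpace ℝ X).symm w) :=
    WeakBilin.eval_continuous (topDualPairing ℝ X).flip f
  have hval : ∀ a b : ℝ, a + b = 1 → f (a • u + b • v) = f u + b * (f v - f u) := by
    intro a b hab
    rw [map_add, map_smul, map_smul, smul_eq_mul, smul_eq_mul, ← eq_sub_iff_add_eq.2 hab |>.symm]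
    ring
  have hdiff : 0 < f v - f u := sub_pos.2 hf
  have hmid : toWeakSpace ℝ X ((1 - t / 2) • u + (t / 2) • v) ∈
      segment ℝ (toWeakSpace ℝ X u) (toWeakSpace ℝ X v) :=
    ⟨1 - t / 2, t / 2, by linarith, by linarith, by ring, by simp⟩
  obtain ⟨_, hw, ⟨a, b, ha, hb, hab, rfl⟩, z, hz, hzw⟩ := mem_closure_iff.1 (hD hmid) _
    (isOpen_Ioo.preimage hfc : IsOpen (_ ⁻¹' Set.Ioo (f u) (f u + t * (f v - f u))))
    (by
      rw [Set.mem_preimage, LinearEquiv.symm_apply_apply, hval _ _ (by ring)]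
      constructor <;> nlinarith)
  have hzab : z = a • u + b • v := (toWeakSpace ℝ X).injective (by rw [hzw]; simp)
  rw [← hzw, Set.mem_preimage, LinearEquiv.symm_apply_apply, hzab, hval a b hab] at hw
  have hb0 : 0 < b := by
    by_contra! h
    nlinarith [hw.1]
  have hbt : b < t := by
    by_contra! h
    nlinarith [hw.2]
  refine ⟨a, b, ha, hb0, hab, hzab ▸ hz, ?_⟩
  have hexp : a • u + b • v = u + b • (v - u) := by
    rw [eq_sub_iff_add_eq.2 hab]
    module
  rw [hexp]
  calc ‖u + b • (v - u)‖ ≤ ‖u‖ + b * ‖v - u‖ := by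
        refine (norm_add_le _ _).trans_eq ?_
        rw [norm_smul, Real.norm_of_nonneg hb]
    _ ≤ r := by nlinarith

/-! ### The equilibrium point -/

theorem theorem4p6 {X : Type*} [NormedAddCommGroup X] [NormedSpace ℝ X] [CompleteSpace X]
    (hX : IsReflexiveSpace X)
    (K : Set X) (hKne : K.Nonempty) (hKconv : Convex ℝ K) (hKclosed : IsClosed K)
    (D : Set X) (hD : SelfSegmentDense (weakSet D) (weakSet K))
    -- only the values of `F` on `K × K` matter
    (F : X → X → Set ℝ)
    (hF₁ : ∀ y ∈ D, ∀ a ∈ K, WeaklyUpperSemicontinuousAt K (fun x => F x y) a)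
    (hF₂ : ∀ x ∈ K, ∀ b ∈ K \ D, WeaklyUpperSemicontinuousAt K (fun y => F x y) b)
    (hF₃ : ∀ x ∈ K, SetValuedConcaveOn D (fun y => F x y))
    (hF₄ : ∀ x ∈ D, (F x x ∩ Set.Ici 0).Nonempty)
    (hF₅ : ∃ r : ℝ, 0 < r ∧ (∃ x ∈ K, ‖x‖ ≤ r) ∧
      ∀ x ∈ K, ‖x‖ ≤ r → ∃ y₀ ∈ D, ‖y₀‖ < r ∧ F x y₀ ⊆ Set.Iic 0) :
    ∃ x₀ ∈ K, ∀ y ∈ K, (F x₀ y ∩ Set.Ici 0).Nonempty := by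
  classical
  obtain ⟨r, -, ⟨x₁, hx₁, hx₁r⟩, hcoer⟩ := hF₅
  obtain ⟨hDK', hDdense, hDseg⟩ := hD
  have hDK : D ⊆ K := (Set.image_subset_image_iff (toWeakSpace ℝ X).injective).1 hDK'
  set S : Set X := K ∩ Metric.closedBall 0 r with hS
  have hSconv : Convex ℝ S := hKconv.inter (convex_closedBall 0 r)
  have hSclosed : IsClosed S := hKclosed.inter Metric.isClosed_closedBall
  have hmemS : ∀ x, x ∈ S ↔ x ∈ K ∧ ‖x‖ ≤ r := fun x => by simp [hS]
  let ι := {y : X // y ∈ D ∧ ‖y‖ ≤ r}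
  let G : ι → Set (WeakSpace ℝ X) := fun y => weakSet {x ∈ S | (F x y ∩ Set.Ici 0).Nonempty}
  have hGclosed : ∀ y, IsClosed (G y) := fun y =>
    isClosed_weakSet_inter_nonneg hSconv hSclosed Set.inter_subset_left (hF₁ y y.2.1)
  have hcomp : IsCompact (weakSet S) := hX.isCompact_weakSet hSconv hSclosed
    (Metric.isBounded_closedBall.subset Set.inter_subset_right)
  have hfin : ∀ u : Finset ι, (weakSet S ∩ ⋂ i ∈ u, G i).Nonempty := by
    intro u
    rcases u.eq_empty_or_nonempty with rfl | hu
    -- The empty intersection leaves `S`, which contains `x₁`.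
    · exact ⟨toWeakSpace ℝ X x₁, ⟨x₁, (hmemS x₁).2 ⟨hx₁, hx₁r⟩, rfl⟩, by simp⟩
    have : Nonempty u := hu.to_subtype
    obtain ⟨x, -, hx⟩ := exists_mem_convexHull_forall_mem hDseg (ι := u)
      (y := fun i => toWeakSpace ℝ X i.1.1) (fun i => ⟨_, i.1.2.1, rfl⟩) (G := fun i => G i.1)
      (fun i => hGclosed i.1) (by
        intro J z hz hzD
        obtain ⟨x, hxD, rfl⟩ := hzD
        let s : Finset X := J.image fun i => i.1.1
        have hxs : x ∈ convexHull ℝ (s : Set X) := by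
          have himg : (fun i : u => toWeakSpace ℝ X i.1.1) '' J =
              (toWeakSpace ℝ X).toLinearMap '' (s : Set X) := by
            simp [s, Set.image_image]
          rw [himg, ← LinearMap.image_convexHull] at hz
          obtain ⟨x', hx', h⟩ := hz
          rwa [← (toWeakSpace ℝ X).injective h]
        have hsD : (s : Set X) ⊆ D := by
          intro y hy
          obtain ⟨i, -, rfl⟩ := Finset.mem_image.1 hy
          exact i.1.2.1
        have hsS : (s : Set X) ⊆ S := by
          intro y hy
          obtain ⟨i, -, rfl⟩ := Finset.mem_image.1 hy
          exact (hmemS _).2 ⟨hDK i.1.2.1, i.1.2.2⟩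
        obtain ⟨y, hy, hFy⟩ := (hF₃ x (hDK hxD)).exists_nonneg hsD hxs hxD (hF₄ x hxD)
        obtain ⟨i, hi, rfl⟩ := Finset.mem_image.1 hy
        exact ⟨i, hi, x, ⟨convexHull_min hsS hSconv hxs, hFy⟩, rfl⟩)
    obtain ⟨i, hi⟩ := hu
    refine ⟨x, ?_, Set.mem_iInter₂.2 fun j hj => hx ⟨j, hj⟩⟩
    exact Set.image_mono (fun x hx => hx.1) (hx ⟨i, hi⟩)
  obtain ⟨_, ⟨x₀, hx₀S, rfl⟩, hx₀⟩ := hcomp.inter_iInter_nonempty G hGclosed hfin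
  obtain ⟨hx₀K, hx₀r⟩ := (hmemS x₀).1 hx₀S
  have hball : ∀ y ∈ D, ‖y‖ ≤ r → (F x₀ y ∩ Set.Ici 0).Nonempty := by
    intro y hy hyr
    obtain ⟨x, hx, h⟩ := Set.mem_iInter.1 hx₀ ⟨y, hy, hyr⟩
    rw [← (toWeakSpace ℝ X).injective h]
    exact hx.2
  have hFD : ∀ y ∈ D, (F x₀ y ∩ Set.Ici 0).Nonempty := by
    intro y hy
    rcases le_or_gt ‖y‖ r with hyr | hyr
    · exact hball y hy hyr
    obtain ⟨y₀, hy₀, hy₀r, hFy₀⟩ := hcoer x₀ hx₀K hx₀r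
    have hne : y₀ ≠ y := by
      rintro rfl
      exact lt_asymm hyr hy₀r
    -- The strict bound `‖y₀‖ < r` leaves room to move towards `y` inside the ball; `0 < b` then
    -- lets the sign pass to the value at `y`.
    obtain ⟨a, b, ha, hb, hab, hzD, hzr⟩ := exists_mem_combination_norm_le hne
      (hDseg _ ⟨y₀, hy₀, rfl⟩ _ ⟨y, hy, rfl⟩) hy₀r
    obtain ⟨v, hv, hv0⟩ := hball _ hzD hzr
    have hsub := hF₃ x₀ hx₀K 2 ![y₀, y] ![a, b] (by simp [Fin.forall_fin_two, hy₀, hy])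
      (by simp [Fin.forall_fin_two, ha, hb.le]) (by simpa using hab) (by simpa using hzD)
    simp only [Fin.sum_univ_two, Matrix.cons_val_zero, Matrix.cons_val_one] at hsub
    obtain ⟨_, ⟨α, hα, rfl⟩, _, ⟨β, hβ, rfl⟩, hαβ⟩ := hsub hv
    refine ⟨β, hβ, ?_⟩
    have hα0 : α ≤ 0 := hFy₀ hα
    have h1 := mul_nonpos_of_nonneg_of_nonpos ha hα0
    have h2 : a * α + b * β = v := hαβ
    have hv0' : 0 ≤ v := hv0
    exact nonneg_of_mul_nonneg_right (by linarith : 0 ≤ b * β) hb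
  refine ⟨x₀, hx₀K, fun y hy => ?_⟩
  by_cases hyD : y ∈ D
  · exact hFD y hyD
  by_contra hneg
  have hev := (hF₂ x₀ hx₀K y ⟨hy, hyD⟩).eventually_subset hneg
  rw [eventually_nhdsWithin_iff] at hev
  obtain ⟨_, hz, ⟨z, hzD, rfl⟩⟩ := mem_closure_iff_nhds.1 (hDdense ⟨y, hy, rfl⟩) _ hev
  exact hz ⟨z, hDK hzD, rfl⟩ (by simpa using hFD z hzD)
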